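/- Time is divided into units, and each unit into $M$ micro-intervals of length $\mu=1/M$. Over $T$ units of time a sender transmits bits $X_1,\dots,X_{MT}$. A noise pattern $\xi\in\{0,1\}^{MT}$ turns them into $Z_j=X_j\oplus\xi(j)$, delays $\Delta(j)\in\mathbb{Z}_{\ge 0}$ are applied, and the receiver sees $Y_1,\dots,Y_{MT}$ with $Y_i=\sum_{j\,:\,j+\Delta(j)=i}Z_j$. In both channels below the delays are independent and memoryless, $\Pr[\Delta(j)=d]=(1-\mu)^d\mu$ for $d\ge 0$. In $D^P|N(\varepsilon)^P$ each bit is flipped independently with probability $\varepsilon$, independently of the delays; in $N(\varepsilon)^A|D^P$ an adversary who knows the sent sequence but not the delays chooses a $\xi$ with at most $\varepsilon MT$ ones. A code for $k$-bit messages consists of an encoder $E:\{0,1\}^k\to\{0,1\}^{MT}$ and a decoder $D:(\mathbb{Z}_{\ge 0})^{MT}\to\{0,1\}^k$; its decoding error probability is $\Pr[D(Y)\ne m]$ for a uniformly random message $m$, in the worst case over the choices of the adversary. For fixed $M$, a family of codes with $k_T$ message bits for every $T\in\mathbb{N}$ is reliable if this probability tends to $0$ as $T\to\infty$; its rate is $\limsup_{T\to\infty}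 k_T/T$. The capacity of a channel is the supremum of the rates of all reliable families, over all $M$. Theorem 2 (Infinite Capacity Case). For every $\varepsilon$ with $0<\varepsilon<1/64$, the channels $D^P|N(\varepsilon)^P$ and $N(\varepsilon)^A|D^P$ have infinite capacity. Moreover, there is an absolute constant $C$ such that for every such $\varepsilon$, each of the two channels, and every real rate $R>0$, there are an integer $M\ge 1$ with $M\le C\max(1,R)^5$ and a $T_0$ such that for all integers $T\ge T_0$ there is a code with $k_T=\lceil RT\rceil$ message bits over $T$ units of time, of granularity $1/M$, whose decoding error probability on that channel is at most $\exp(-T)$. -/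

import Mathlib

open MeasureTheory ProbabilityTheory Filter
open scoped ENNReal

noncomputable section

namespace DelayChannel

/-- The length `1 / M` of a micro-interval, seen as a probability. -/
def microLength (M : ℕ+) : unitInterval :=
  ⟨1 / (M : ℝ), by positivity, by
    rw [div_le_one (by exact_mod_cast M.pos)]
    exact_mod_cast (one_le : 1 ≤ M)⟩

/-- The sequence received when the bits `X` are sent, the noise flips the bits marked by `ξ` and
bit `j` is delayed by `Δ j` micro-intervals: `Y i` is the sum of the (noisy) bits arriving in
micro-interval `i`. Bits that arrive after the last micro-interval are not received. -/
def received {n : ℕ} (X ξ : Fin n → Bool) (Δ : Fin n → ℕ) (i : Fin n) : ℕ :=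
  ∑ j : Fin n, if (j : ℕ) + Δ j = i then (xor (X j) (ξ j)).toNat else 0

/-- The law of the random delays: independent and memoryless. In each micro-interval, starting
with the one in which it is sent, a bit that is still in the queue leaves it with probability
`1 / M`. -/
def delayLaw (M : ℕ+) (n : ℕ) : Measure (Fin n → ℕ) :=
  Measure.pi fun _ => geometricMeasure (microLength M)

/-- The law of the random noise: every bit is flipped independently with probability `ε`. -/
def noiseLaw (ε : unitInterval) (n : ℕ) : Measure (Fin n → Bool) :=
  Measure.pi fun _ => bernoulliMeasure true false ε

/-- A channel over `T` units of time, cut into `M` micro-intervals each, assigns to every sent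
sequence the set of the laws of the received sequence among which the adversary may choose.
A purely probabilistic channel has exactly one such law. -/
abbrev Channel : Type :=
  ∀ (M : ℕ+) (T : ℕ), (Fin (M * T) → Bool) → Set (Measure (Fin (M * T) → ℕ))

/-- The channel `D^P | N(ε)^P`: random delays, then random noise. -/
def randDelayRandNoise (ε : unitInterval) : Channel := fun M T X =>
  {((delayLaw M (M * T)).prod (noiseLaw ε (M * T))).map fun ω => received X ω.2 ω.1}

/-- The channel `N(ε)^A | D^P`: an adversary who knows the sent sequence, but not the delays, flips
at most a fraction `ε` of all bits; then the delays are random. -/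
def advNoiseRandDelay (ε : unitInterval) : Channel := fun M T X =>
  {P | ∃ ξ : Fin (M * T) → Bool,
    ((Finset.univ.filter fun j => ξ j = true).card : ℝ) ≤ ε * (M * T) ∧
    P = (delayLaw M (M * T)).map (received X ξ)}

/-- An encoder and a decoder for messages of `k` bits over `T` units of time, cut into `M`
micro-intervals each. -/
structure Code (M : ℕ+) (T k : ℕ) where
  /-- the encoder -/
  enc : (Fin k → Bool) → (Fin (M * T) → Bool)
  /-- the decoder -/
  dec : (Fin (M * T) → ℕ) → (Fin k → Bool)

/-- The decoding error probability for a uniformly random message, the adversary (if there is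
one) choosing the worst law for each message. -/
def Code.decError {M : ℕ+} {T k : ℕ} (c : Code M T k) (ch : Channel) : ℝ≥0∞ :=
  (∑ m : Fin k → Bool, ⨆ P ∈ ch M T (c.enc m), P {Y | c.dec Y ≠ m}) / 2 ^ k

/-- A communication system of granularity `1 / M`: a code for every length of time. -/
structure System (M : ℕ+) where
  /-- the number of message bits -/
  k : ℕ → ℕ
  /-- the encoders and decoders -/
  code : ∀ T : ℕ, Code M T (k T)

/-- The decoding error probability tends to zero. -/
def System.Reliable {M : ℕ+} (S : System M) (ch : Channel) : Prop :=
  Tendsto (fun T => (S.code T).decError ch) atTop (nhds 0)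

/-- The asymptotic rate `limsup k_T / T`. -/
def System.rate {M : ℕ+} (S : System M) : ℝ≥0∞ :=
  limsup (fun T : ℕ => (S.k T : ℝ≥0∞) / (T : ℝ≥0∞)) atTop

/-- The capacity: the supremum of the rates of all reliable communication systems, of all
granularities. -/
def capacity (ch : Channel) : ℝ≥0∞ :=
  ⨆ (M : ℕ+) (S : System M) (_ : S.Reliable ch), S.rate

end DelayChannel

end

noncomputable section

namespace DelayChannel

/-! The received sequence is linear in the noisy bits, and the geometric delay kernel has a two-term
inverse. For any `v` vanishing from `n` on, the weights `inverseFilter M v` make the weighted sum of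
the counts an exactly unbiased estimate of the sum of `Z j * v j` (`integral_inverseFilter`). These
weights are at most `M` times the increments of `v` plus its size, so a slowly varying `v` gives an
estimate that Hoeffding's inequality concentrates well.

The code repeats each bit of a code of relative distance 1/4 over a block of length `2 * h`. The
decoder maximises the estimated correlation with a train of triangular pulses, which has increments
at most `1 / h`. Between two codewords the clean correlations differ by at least `n / 8`, and `n /
32` flips cost at most `n / 16` of this, so an error needs a deviation of `n / 16`, uniformly in the
noise pattern (`delayLaw_correlation_le`).

With `M` of order `r ^ 3` and `h` of order `r ^ 2` the weights are of order `r`. The error exponent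
is then of order `M * T / r ^ 2`, that is `r * T`, enough for a union bound over `2 ^ (r * T)`
messages. Random noise of rate below 1/64 exceeds density 1/32 only with exponentially small
probability. -/

/-! ### Concentration of sums of functions of independent variables -/

/-- Hoeffding's inequality on a finite power of a discrete probability space. -/
lemma pi_real_add_le_sum_le {ι Ω : Type*} [Fintype ι] [MeasurableSpace Ω] [DiscreteMeasurableSpace Ω]
    (μ : Measure Ω) [IsProbabilityMeasure μ] (f : ι → Ω → ℝ) {a b t : ℝ}
    (hf : ∀ j x, f j x ∈ Set.Icc a b) (ht : 0 ≤ t) :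
    (Measure.pi fun _ : ι => μ).real {ω | ∑ j, ∫ x, f j x ∂μ + t ≤ ∑ j, f j (ω j)} ≤
      Real.exp (-(2 * t ^ 2) / (Fintype.card ι * (b - a) ^ 2)) := by
  have hind : iIndepFun (fun j (ω : ι → Ω) => f j (ω j) - ∫ x, f j x ∂μ)
      (Measure.pi fun _ : ι => μ) :=
    iIndepFun_pi (X := fun j x => f j x - ∫ x, f j x ∂μ)
      fun j => (Measurable.of_discrete).aemeasurable
  have hsub : ∀ j ∈ Finset.univ, HasSubgaussianMGF
      (fun ω : ι → Ω => f j (ω j) - ∫ x, f j x ∂μ) ((‖b - a‖₊ / 2) ^ 2)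
      (Measure.pi fun _ : ι => μ) := by
    intro j _
    have := hasSubgaussianMGF_of_mem_Icc (μ := Measure.pi fun _ : ι => μ)
      (X := fun ω => f j (ω j)) (a := a) (b := b)
      ((Measurable.of_discrete (f := f j)).comp (measurable_pi_apply j)).aemeasurable
      (ae_of_all _ fun ω => hf j (ω j))
    rwa [integral_comp_eval (Measurable.of_discrete (f := f j)).aestronglyMeasurable] at this
  have h := HasSubgaussianMGF.measure_sum_ge_le_of_iIndepFun hind hsub ht
  have hset : {ω : ι → Ω | ∑ j, ∫ x, f j x ∂μ + t ≤ ∑ j, f j (ω j)} =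
      {ω | t ≤ ∑ j, (f j (ω j) - ∫ x, f j x ∂μ)} := by
    ext ω
    simp only [Set.mem_ofPred_eq, Finset.sum_sub_distrib]
    constructor <;> intro h <;> linarith
  rw [hset]
  refine h.trans_eq ?_
  congr 1
  simp only [Finset.sum_const, Finset.card_univ, nsmul_eq_mul, NNReal.coe_mul, NNReal.coe_natCast,
    NNReal.coe_pow, NNReal.coe_div, coe_nnnorm, Real.norm_eq_abs, NNReal.coe_ofNat, div_pow,
    sq_abs]
  -- If the denominator vanishes, both quotients are 0 by the convention for division by zero.
  rcases eq_or_ne ((Fintype.card ι : ℝ) * (b - a) ^ 2) 0 with h0 | h0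
  · rw [h0, show (2 : ℝ) * (Fintype.card ι * ((b - a) ^ 2 / 2 ^ 2)) =
      (Fintype.card ι * (b - a) ^ 2) / 2 by ring, h0]
    simp
  · rw [div_eq_div_iff (by intro h; apply h0; linarith) h0]
    ring

/-! ### The linear filter inverting the delays -/

/-- The weights for which the weighted sum of the received numbers is an unbiased estimate of the
sum of the bits weighted by `v`. -/
def inverseFilter (M : ℕ+) (v : ℕ → ℝ) (i : ℕ) : ℝ := M * (v i - (1 - 1 / M) * v (i + 1))

lemma inverseFilter_sub (M : ℕ+) (v w : ℕ → ℝ) (i : ℕ) :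
    inverseFilter M (fun j => v j - w j) i = inverseFilter M v i - inverseFilter M w i := by
  simp only [inverseFilter]; ring

/-- The weight equals `M * (v i - v (i + 1)) + v (i + 1)`: the large factor meets only the
increments. -/
lemma abs_inverseFilter_le (M : ℕ+) {v : ℕ → ℝ} {a b : ℝ} (ha : ∀ i, |v i - v (i + 1)| ≤ a)
    (hb : ∀ i, |v i| ≤ b) (i : ℕ) : |inverseFilter M v i| ≤ M * a + b := by
  have hM : (0 : ℝ) < M := by exact_mod_cast M.pos
  have : inverseFilter M v i = M * (v i - v (i + 1)) + v (i + 1) := by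
    simp only [inverseFilter]; field_simp; ring
  rw [this]
  refine (abs_add_le _ _).trans (add_le_add ?_ (hb _))
  rw [abs_mul, abs_of_pos hM]
  exact mul_le_mul_of_nonneg_left (ha i) hM.le

/-- The expectation is a telescoping series in `(1 - 1 / M) ^ d * v (j + d)`. -/
lemma integral_inverseFilter (M : ℕ+) {v : ℕ → ℝ} {n : ℕ} (hv : ∀ i, n ≤ i → v i = 0) (j : ℕ) :
    ∫ d, inverseFilter M v (j + d) ∂geometricMeasure (microLength M) = v j := by
  have hM : (0 : ℝ) < M := by exact_mod_cast M.pos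
  have h0 : microLength M ≠ 0 := by
    intro h
    have := congrArg Subtype.val h
    simp [microLength] at this
  rw [integral_geometricMeasure h0]
  have hterm : ∀ d : ℕ, ((1 - (microLength M : ℝ)) ^ d * (microLength M : ℝ)) •
      inverseFilter M v (j + d) =
      (1 - 1 / (M : ℝ)) ^ d * v (j + d) - (1 - 1 / (M : ℝ)) ^ (d + 1) * v (j + (d + 1)) := by
    intro d
    simp only [microLength, inverseFilter, smul_eq_mul, ← add_assoc, pow_succ]
    field_simp
  simp_rw [hterm]
  rw [tsum_eq_sum (s := Finset.range n), Finset.sum_range_sub']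
  · simp [hv (j + n) (by omega)]
  · intro d hd
    rw [Finset.mem_range, not_lt] at hd
    rw [hv _ (by omega), hv _ (by omega)]
    simp

/-- Bits arriving too late are lost, but they would carry weight 0. -/
lemma sum_mul_received {n : ℕ} (X ξ : Fin n → Bool) (Δ : Fin n → ℕ) {w : ℕ → ℝ}
    (hw : ∀ i, n ≤ i → w i = 0) :
    ∑ i : Fin n, w i * (received X ξ Δ i : ℝ) =
      ∑ j : Fin n, ((xor (X j) (ξ j)).toNat : ℝ) * w (j + Δ j) := by
  simp only [received, Nat.cast_sum, Finset.mul_sum]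
  rw [Finset.sum_comm]
  refine Finset.sum_congr rfl fun j _ => ?_
  by_cases h : (j : ℕ) + Δ j < n
  · rw [Finset.sum_eq_single ⟨(j : ℕ) + Δ j, h⟩]
    · simp [mul_comm]
    · intro i _ hi
      rw [if_neg]
      · simp
      · intro h'
        exact hi (Fin.ext h'.symm)
    · simp
  · rw [hw _ (not_lt.mp h), mul_zero]
    refine Finset.sum_eq_zero fun i _ => ?_
    rw [if_neg]
    · simp
    · have := i.2
      omega

lemma inverseFilter_eq_zero (M : ℕ+) {v : ℕ → ℝ} {n : ℕ} (hv : ∀ i, n ≤ i → v i = 0) (i : ℕ)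
    (hi : n ≤ i) : inverseFilter M v i = 0 := by
  simp [inverseFilter, hv i hi, hv (i + 1) (by omega)]

/-- The filtered received sequence is unlikely to fall below its mean by `t`. -/
lemma delayLaw_sum_inverseFilter_le (M : ℕ+) {n : ℕ} (X ξ : Fin n → Bool) {v : ℕ → ℝ}
    (hv : ∀ i, n ≤ i → v i = 0) {K t : ℝ} (hK : ∀ i, |inverseFilter M v i| ≤ K) (ht : 0 ≤ t) :
    (delayLaw M n).real {Δ | ∑ i : Fin n, inverseFilter M v i * (received X ξ Δ i : ℝ) ≤
        ∑ j : Fin n, ((xor (X j) (ξ j)).toNat : ℝ) * v j - t} ≤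
      Real.exp (-t ^ 2 / (2 * n * K ^ 2)) := by
  have hmem : ∀ (j : Fin n) (d : ℕ),
      -(((xor (X j) (ξ j)).toNat : ℝ) * inverseFilter M v (j + d)) ∈ Set.Icc (-K) K := by
    intro j d
    have h := abs_le.mp (hK (j + d))
    have hK0 : 0 ≤ K := (abs_nonneg _).trans (hK 0)
    rcases xor (X j) (ξ j) with _ | _
    · simpa using hK0
    · simp only [Bool.toNat_true, Nat.cast_one, one_mul, Set.mem_Icc]
      constructor <;> linarith [h.1, h.2]
  have h := pi_real_add_le_sum_le (geometricMeasure (microLength M)) _ hmem ht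
  simp_rw [integral_neg, integral_const_mul, integral_inverseFilter M hv] at h
  have hset : {Δ : Fin n → ℕ | ∑ i : Fin n, inverseFilter M v i * (received X ξ Δ i : ℝ) ≤
        ∑ j : Fin n, ((xor (X j) (ξ j)).toNat : ℝ) * v j - t} =
      {Δ | ∑ j : Fin n, -(((xor (X j) (ξ j)).toNat : ℝ) * v j) + t ≤
        ∑ j : Fin n, -(((xor (X j) (ξ j)).toNat : ℝ) * inverseFilter M v (j + Δ j))} := by
    ext Δ
    rw [Set.mem_ofPred_eq, Set.mem_ofPred_eq,
      sum_mul_received X ξ Δ (inverseFilter_eq_zero M hv), Finset.sum_neg_distrib,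
      Finset.sum_neg_distrib]
    constructor <;> intro h <;> linarith
  rw [hset, delayLaw]
  refine h.trans_eq ?_
  rw [Fintype.card_fin]
  congr 1
  rw [show (n : ℝ) * (K - -K) ^ 2 = 2 * (2 * n * K ^ 2) by ring, neg_div, neg_div,
    mul_div_mul_left _ _ two_ne_zero]

/-! ### Binary codes of large distance -/

/-- The sum factors over coordinates, an agreement weighing 3 and a disagreement 1. -/
lemma sum_pow_hammingDist {N : ℕ} (x : Fin N → Bool) :
    ∑ y : Fin N → Bool, 3 ^ (N - hammingDist x y) = 4 ^ N := by
  have hterm : ∀ y : Fin N → Bool,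
      3 ^ (N - hammingDist x y) = ∏ i, if x i = y i then 3 else 1 := by
    intro y
    rw [Finset.prod_ite, Finset.prod_const, Finset.prod_const_one, mul_one]
    congr 1
    have := Finset.card_filter_add_card_filter_not (s := (Finset.univ : Finset (Fin N)))
      (fun i => x i = y i)
    rw [Finset.card_univ, Fintype.card_fin] at this
    simp only [hammingDist, ne_eq]
    omega
  simp_rw [hterm]
  rw [← Fintype.prod_sum (f := fun i b => if x i = b then 3 else 1)]
  have : ∀ i, ∑ b, (if x i = b then 3 else 1) = 4 := by
    intro i
    cases x i <;> simp
  rw [Finset.prod_congr rfl fun i _ => this i, Finset.prod_const, Finset.card_univ,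
    Fintype.card_fin]

/-- A Markov-type bound: every word of the ball contributes at least `3 ^ (N - r)` to the preceding
sum. -/
lemma card_hammingDist_lt_mul_le {N r : ℕ} (x : Fin N → Bool) :
    (Finset.univ.filter fun y => hammingDist x y < r).card * 3 ^ (N - r) ≤ 4 ^ N := by
  rw [← sum_pow_hammingDist x, ← smul_eq_mul, ← Finset.sum_const]
  refine (Finset.sum_le_sum fun y hy => ?_).trans
    (Finset.sum_le_sum_of_subset (Finset.filter_subset _ _))
  refine Nat.pow_le_pow_right (by norm_num) ?_
  have := (Finset.mem_filter.mp hy).2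
  omega

/-- A Gilbert–Varshamov bound: there are codes of rate `1 / 8` and relative distance `1 / 4`. -/
lemma exists_code_hammingDist_ge {k q : ℕ} (hk : k ≤ q) :
    ∃ c : (Fin k → Bool) → (Fin (8 * q) → Bool),
      ∀ m m', m ≠ m' → 2 * q ≤ hammingDist (c m) (c m') := by
  have hgreedy : ∀ s ≤ 2 ^ k, ∃ S : Finset (Fin (8 * q) → Bool), S.card = s ∧
      ∀ x ∈ S, ∀ y ∈ S, x ≠ y → 2 * q ≤ hammingDist x y := by
    intro s
    induction s with
    | zero => exact fun _ => ⟨∅, by simp⟩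
    | succ s ih =>
      intro hs
      obtain ⟨S, hcard, hS⟩ := ih (by omega)
      set U := S.biUnion fun x => Finset.univ.filter fun y => hammingDist x y < 2 * q
      have hU : U.card < Fintype.card (Fin (8 * q) → Bool) := by
        have h1 : U.card * 3 ^ (6 * q) ≤ s * 4 ^ (8 * q) := by
          calc U.card * 3 ^ (6 * q) ≤ (∑ x ∈ S,
                (Finset.univ.filter fun y => hammingDist x y < 2 * q).card) * 3 ^ (6 * q) :=
              Nat.mul_le_mul_right _ Finset.card_biUnion_le
            _ ≤ ∑ _x ∈ S, 4 ^ (8 * q) := by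
              rw [Finset.sum_mul]
              refine Finset.sum_le_sum fun x _ => ?_
              have := card_hammingDist_lt_mul_le (r := 2 * q) x
              rwa [show 8 * q - 2 * q = 6 * q by omega] at this
            _ = s * 4 ^ (8 * q) := by rw [Finset.sum_const, hcard, smul_eq_mul]
        have h2 : s < 2 ^ q := (Nat.lt_of_succ_le hs).trans_le (Nat.pow_le_pow_right (by norm_num) hk)
        -- For `q = 1` this is 131072 ≤ 186624; the rest is a `q`-th power.
        have h3 : (2 : ℕ) ^ q * 4 ^ (8 * q) ≤ 2 ^ (8 * q) * 3 ^ (6 * q) := by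
          rw [pow_mul, pow_mul, pow_mul, ← mul_pow, ← mul_pow]
          exact Nat.pow_le_pow_left (by norm_num) q
        have h4 : U.card * 3 ^ (6 * q) < 2 ^ (8 * q) * 3 ^ (6 * q) :=
          h1.trans_lt ((Nat.mul_lt_mul_of_pos_right h2 (by positivity)).trans_le h3)
        simpa using Nat.lt_of_mul_lt_mul_right h4
      obtain ⟨y, hy⟩ : ∃ y, y ∉ U := by
        by_contra! h
        exact hU.ne (Finset.card_eq_iff_eq_univ _ |>.mpr (Finset.eq_univ_of_forall h))
      have hyS : ∀ x ∈ S, 2 * q ≤ hammingDist x y := by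
        intro x hx
        by_contra! h
        exact hy (Finset.mem_biUnion.mpr ⟨x, hx, by simpa using h⟩)
      -- Here distance 0 suffices, so `y` need not be new; but then `k = 0` and one word is enough.
      by_cases hq : q = 0
      · have : (2 : ℕ) ^ k = 1 := by
          rw [show k = 0 by omega, pow_zero]
        exact ⟨{y}, by rw [Finset.card_singleton]; omega, by simp [hq]⟩
      have hyn : y ∉ S := fun h => by
        have := hyS y h
        rw [hammingDist_self] at this
        omega
      refine ⟨insert y S, by rw [Finset.card_insert_of_notMem hyn, hcard], ?_⟩
      intro a ha b hb hab
      rcases Finset.mem_insert.mp ha with h | ha <;> rcases Finset.mem_insert.mp hb with h' | hb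
      · exact absurd (h.trans h'.symm) hab
      · rw [h, hammingDist_comm]; exact hyS b hb
      · rw [h']; exact hyS a ha
      · exact hS a ha b hb hab
  obtain ⟨S, hcard, hS⟩ := hgreedy _ le_rfl
  have e : (Fin k → Bool) ≃ S := Fintype.equivOfCardEq (by simp [hcard])
  exact ⟨fun m => e m, fun m m' h => hS _ (e m).2 _ (e m').2
    fun h' => h (e.injective (Subtype.ext h'))⟩

/-! ### Triangular pulses -/

/-- A train of triangular pulses of width `2 * h` and heights `σ 0, σ 1, …`. -/
def pulse (h : ℕ) (σ : ℕ → ℝ) (j : ℕ) : ℝ :=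
  σ (j / (2 * h)) * ((min (j % (2 * h)) (2 * h - j % (2 * h)) : ℕ) / h)

lemma pulse_sub (h : ℕ) (σ τ : ℕ → ℝ) (j : ℕ) :
    pulse h (fun b => σ b - τ b) j = pulse h σ j - pulse h τ j := by
  simp only [pulse]; ring

lemma pulse_eq_zero {h N : ℕ} (hh : 0 < h) {σ : ℕ → ℝ} (hσ : ∀ b, N ≤ b → σ b = 0) (j : ℕ)
    (hj : N * (2 * h) ≤ j) : pulse h σ j = 0 := by
  rw [pulse, hσ _ ((Nat.le_div_iff_mul_le (by omega)).mpr hj), zero_mul]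

lemma abs_pulse_le {h : ℕ} (hh : 0 < h) {σ : ℕ → ℝ} {a : ℝ} (hσ : ∀ b, |σ b| ≤ a) (j : ℕ) :
    |pulse h σ j| ≤ a := by
  have hh' : (0 : ℝ) < h := by exact_mod_cast hh
  have h1 : ((min (j % (2 * h)) (2 * h - j % (2 * h)) : ℕ) / h : ℝ) ≤ 1 := by
    rw [div_le_one hh']
    exact_mod_cast (show min (j % (2 * h)) (2 * h - j % (2 * h)) ≤ h by omega)
  rw [pulse, abs_mul, abs_of_nonneg (a := (_ / _ : ℝ)) (by positivity)]
  calc _ ≤ |σ (j / (2 * h))| * 1 := mul_le_mul_of_nonneg_left h1 (abs_nonneg _)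
    _ ≤ a := by rw [mul_one]; exact hσ _

lemma abs_pulse_sub_succ_le {h : ℕ} (hh : 0 < h) {σ : ℕ → ℝ} {a : ℝ} (hσ : ∀ b, |σ b| ≤ a)
    (j : ℕ) : |pulse h σ j - pulse h σ (j + 1)| ≤ a / h := by
  have hh' : (0 : ℝ) < h := by exact_mod_cast hh
  obtain ⟨b, o, ho, rfl⟩ : ∃ b o, o < 2 * h ∧ j = o + 2 * h * b :=
    ⟨j / (2 * h), j % (2 * h), Nat.mod_lt _ (by omega), (Nat.mod_add_div j (2 * h)).symm⟩
  have key : ∀ p : ℕ, p < 2 * h →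
      pulse h σ (p + 2 * h * b) = σ b * ((min p (2 * h - p) : ℕ) / h) := by
    intro p hp
    rw [pulse, Nat.add_mul_div_left _ _ (by omega), Nat.div_eq_of_lt hp, zero_add,
      Nat.add_mul_mod_self_left, Nat.mod_eq_of_lt hp]
  -- The successor of the last offset lies in the next block. The pulse starts there at 0, matching
  -- the formula at offset `2 * h`, so a change of height causes no jump.
  have hlast : pulse h σ (o + 2 * h * b + 1) = σ b * ((min (o + 1) (2 * h - (o + 1)) : ℕ) / h) := by
    rcases Nat.lt_or_ge (o + 1) (2 * h) with h1 | h1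
    · rw [← key _ h1]; congr 1; omega
    · have h2 : o + 1 = 2 * h := by omega
      rw [show o + 2 * h * b + 1 = 2 * h * (b + 1) by rw [mul_add]; omega, h2]
      simp [pulse]
  rw [key o ho, hlast, ← mul_sub, ← sub_div, abs_mul, abs_div, abs_of_pos hh', mul_div_assoc']
  refine div_le_div_of_nonneg_right ?_ hh'.le
  have h1 : |((min o (2 * h - o) : ℕ) : ℝ) - (min (o + 1) (2 * h - (o + 1)) : ℕ)| ≤ 1 := by
    have h2 : min o (2 * h - o) ≤ min (o + 1) (2 * h - (o + 1)) + 1 := by omega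
    have h3 : min (o + 1) (2 * h - (o + 1)) ≤ min o (2 * h - o) + 1 := by omega
    have h2' : ((min o (2 * h - o) : ℕ) : ℝ) ≤ (min (o + 1) (2 * h - (o + 1)) : ℕ) + 1 := by
      exact_mod_cast h2
    have h3' : ((min (o + 1) (2 * h - (o + 1)) : ℕ) : ℝ) ≤ (min o (2 * h - o) : ℕ) + 1 := by
      exact_mod_cast h3
    rw [abs_le]
    constructor <;> linarith
  calc _ ≤ |σ b| * 1 := mul_le_mul_of_nonneg_left h1 (abs_nonneg _)
    _ ≤ a := by rw [mul_one]; exact hσ _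

/-- The values at `o` and `h + o` add up to `h`. -/
lemma sum_range_min_sub (h : ℕ) : ∑ o ∈ Finset.range (2 * h), min o (2 * h - o) = h * h := by
  rw [two_mul, Finset.sum_range_add, ← Finset.sum_add_distrib]
  rw [Finset.sum_congr rfl (g := fun _ => h)]
  · simp
  · intro o ho
    have := Finset.mem_range.mp ho
    omega

/-- Each unit triangle has total mass `h`. -/
lemma sum_mul_pulse {h : ℕ} (hh : 0 < h) (f σ : ℕ → ℝ) (N : ℕ) :
    ∑ j ∈ Finset.range (N * (2 * h)), f (j / (2 * h)) * pulse h σ j =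
      h * ∑ b ∈ Finset.range N, f b * σ b := by
  have hh' : (0 : ℝ) < h := by exact_mod_cast hh
  induction N with
  | zero => simp
  | succ N ih =>
    rw [Nat.succ_mul, Finset.sum_range_add, ih, Finset.sum_range_succ, mul_add]
    congr 1
    have : ∀ o ∈ Finset.range (2 * h),
        f ((N * (2 * h) + o) / (2 * h)) * pulse h σ (N * (2 * h) + o) =
        f N * σ N / h * (min o (2 * h - o) : ℕ) := by
      intro o ho
      have ho := Finset.mem_range.mp ho
      rw [pulse, add_comm, Nat.add_mul_div_right _ _ (by omega), Nat.div_eq_of_lt ho, zero_add,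
        Nat.add_mul_mod_self_right, Nat.mod_eq_of_lt ho]
      ring
    rw [Finset.sum_congr rfl this, ← Finset.mul_sum, ← Nat.cast_sum, sum_range_min_sub]
    push_cast
    field_simp

/-! ### Repetition of the code bits -/

/-- The signs of a bit sequence, extended by zero. -/
def signs {N : ℕ} (c : Fin N → Bool) (b : ℕ) : ℝ :=
  if hb : b < N then (if c ⟨b, hb⟩ then 1 else -1) else 0

lemma signs_eq_zero {N : ℕ} (c : Fin N → Bool) (b : ℕ) (hb : N ≤ b) : signs c b = 0 :=
  dif_neg (by omega)

lemma abs_signs_le {N : ℕ} (c : Fin N → Bool) (b : ℕ) : |signs c b| ≤ 1 := by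
  unfold signs
  split_ifs <;> simp

lemma abs_signs_sub_le {N : ℕ} (c c' : Fin N → Bool) (b : ℕ) : |signs c b - signs c' b| ≤ 2 := by
  have := abs_sub (signs c b) (signs c' b)
  linarith [abs_signs_le c b, abs_signs_le c' b]

lemma sum_signs_mul_sub {N : ℕ} (c c' : Fin N → Bool) :
    ∑ b ∈ Finset.range N, signs c b / 2 * (signs c b - signs c' b) = hammingDist c c' := by
  rw [Finset.sum_range, hammingDist, Finset.card_filter, Nat.cast_sum]
  refine Finset.sum_congr rfl fun b _ => ?_
  simp only [signs, b.2, dif_pos, Fin.eta]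
  cases c b <;> cases c' b <;> norm_num

/-- Every bit is repeated `w` times. -/
def repeatBits {N : ℕ} (w n : ℕ) (c : Fin N → Bool) (j : Fin n) : Bool :=
  if hb : (j : ℕ) / w < N then c ⟨j / w, hb⟩ else false

lemma repeatBits_toNat_sub {N w n : ℕ} (hn : n = N * w) (c : Fin N → Bool) (j : Fin n) :
    ((repeatBits w n c j).toNat : ℝ) - 1 / 2 = signs c (j / w) / 2 := by
  have hb : (j : ℕ) / w < N := Nat.div_lt_of_lt_mul (by rw [mul_comm, ← hn]; exact j.2)
  rw [repeatBits, signs, dif_pos hb, dif_pos hb]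
  cases c ⟨j / w, hb⟩ <;> norm_num

/-- A clean bit minus 1/2 is half its sign, so each position where the codewords differ contributes
`h`. A flip changes one term by at most `|v j| ≤ 2`. -/
lemma sum_noisy_mul_pulse_ge {N h n : ℕ} (hh : 0 < h) (hn : n = N * (2 * h))
    (c c' : Fin N → Bool) (ξ : Fin n → Bool) :
    (h : ℝ) * hammingDist c c' - 2 * (Finset.univ.filter fun j => ξ j = true).card ≤
      ∑ j : Fin n, ((xor (repeatBits (2 * h) n c j) (ξ j)).toNat : ℝ) *
          pulse h (fun b => signs c b - signs c' b) j -
        (∑ j : Fin n, pulse h (fun b => signs c b - signs c' b) j) / 2 := by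
  set v := pulse h (fun b => signs c b - signs c' b) with hv
  have hclean : ∑ j : Fin n, (((repeatBits (2 * h) n c j).toNat : ℝ) - 1 / 2) * v j =
      h * hammingDist c c' := by
    simp_rw [repeatBits_toNat_sub hn]
    rw [← sum_signs_mul_sub, hv, ← sum_mul_pulse hh (fun b => signs c b / 2), ← hn,
      Finset.sum_range]
  have hterm : ∀ j : Fin n, (((repeatBits (2 * h) n c j).toNat : ℝ) - 1 / 2) * v j -
      2 * (if ξ j = true then 1 else 0) ≤
      ((xor (repeatBits (2 * h) n c j) (ξ j)).toNat : ℝ) * v j - v j / 2 := by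
    intro j
    have := abs_le.mp (abs_pulse_le hh (abs_signs_sub_le c c') j)
    rw [← hv] at this
    cases repeatBits (2 * h) n c j <;> cases ξ j <;> norm_num <;> linarith
  have := Finset.sum_le_sum fun j (_ : j ∈ (Finset.univ : Finset (Fin n))) => hterm j
  rw [Finset.sum_sub_distrib, Finset.sum_sub_distrib, hclean, ← Finset.mul_sum,
    ← Finset.sum_div] at this
  rw [Finset.card_filter, Nat.cast_sum]
  simp only [Nat.cast_ite, Nat.cast_one, Nat.cast_zero]
  exact this

/-! ### The correlation decoder -/

instance (M : ℕ+) (n : ℕ) : IsProbabilityMeasure (delayLaw M n) :=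
  inferInstanceAs (IsProbabilityMeasure (Measure.pi _))

instance (ε : unitInterval) (n : ℕ) : IsProbabilityMeasure (noiseLaw ε n) :=
  inferInstanceAs (IsProbabilityMeasure (Measure.pi _))

/-- The estimated correlation of the sent sequence with the pulse train of the codeword `c`. -/
def correlation (M : ℕ+) (h : ℕ) {N n : ℕ} (c : Fin N → Bool) (Y : Fin n → ℕ) : ℝ :=
  ∑ i : Fin n, inverseFilter M (pulse h (signs c)) i * (Y i : ℝ) -
    (∑ j : Fin n, pulse h (signs c) j) / 2

lemma correlation_sub (M : ℕ+) (h : ℕ) {N n : ℕ} (c c' : Fin N → Bool) (Y : Fin n → ℕ) :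
    correlation M h c Y - correlation M h c' Y =
      ∑ i : Fin n, inverseFilter M (pulse h fun b => signs c b - signs c' b) i * (Y i : ℝ) -
        (∑ j : Fin n, pulse h (fun b => signs c b - signs c' b) j) / 2 := by
  have hp : pulse h (fun b => signs c b - signs c' b) =
      fun j => pulse h (signs c) j - pulse h (signs c') j := funext fun j => pulse_sub _ _ _ _
  simp only [correlation, hp, inverseFilter_sub, sub_mul, Finset.sum_sub_distrib]
  ring

/-- The code that repeats the bits of the codewords `c m` and decodes to a message with the largest
estimated correlation. -/
def repetitionCode (M : ℕ+) (T h : ℕ) {N k : ℕ} (c : (Fin k → Bool) → (Fin N → Bool)) :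
    Code M T k where
  enc m := repeatBits (2 * h) (M * T) (c m)
  dec Y := (Finite.exists_max fun m => correlation M h (c m) Y).choose

lemma repetitionCode_dec_spec (M : ℕ+) (T h : ℕ) {N k : ℕ} (c : (Fin k → Bool) → (Fin N → Bool))
    (Y : Fin (M * T) → ℕ) (m : Fin k → Bool) :
    correlation M h (c m) Y ≤ correlation M h (c ((repetitionCode M T h c).dec Y)) Y :=
  (Finite.exists_max fun m => correlation M h (c m) Y).choose_spec m

lemma delayLaw_correlation_le {M : ℕ+} {h N n : ℕ} (hh : 0 < h) (hn : n = N * (2 * h))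
    (c c' : Fin N → Bool) (hc : N ≤ 4 * hammingDist c c') (ξ : Fin n → Bool)
    (hξ : ((Finset.univ.filter fun j => ξ j = true).card : ℝ) ≤ n / 32) :
    (delayLaw M n).real {Δ | correlation M h c (received (repeatBits (2 * h) n c) ξ Δ) ≤
        correlation M h c' (received (repeatBits (2 * h) n c) ξ Δ)} ≤
      Real.exp (-n / (512 * (M * (2 / h) + 2) ^ 2)) := by
  set v := pulse h (fun b => signs c b - signs c' b) with hv
  have hv0 : ∀ i, n ≤ i → v i = 0 := fun i hi => pulse_eq_zero hh (N := N)
    (fun b hb => by rw [signs_eq_zero c b hb, signs_eq_zero c' b hb, sub_zero]) i (hn ▸ hi)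
  have hK := abs_inverseFilter_le M (v := v) (abs_pulse_sub_succ_le hh (abs_signs_sub_le c c'))
    (abs_pulse_le hh (abs_signs_sub_le c c'))
  have hmean := sum_noisy_mul_pulse_ge hh hn c c' ξ
  have hnR : (n : ℝ) = N * (2 * h) := by rw [hn]; push_cast; ring
  have hcR : (N : ℝ) ≤ 4 * hammingDist c c' := by exact_mod_cast hc
  have hsig : (n : ℝ) / 8 ≤ h * hammingDist c c' := by
    rw [hnR]
    nlinarith [mul_le_mul_of_nonneg_left hcR (Nat.cast_nonneg (α := ℝ) h)]
  -- The signal `n / 8` minus the noise loss `2 * (n / 32)` leaves `n / 16`.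
  have hb := delayLaw_sum_inverseFilter_le M (repeatBits (2 * h) n c) ξ hv0 hK
    (t := n / 16) (by positivity)
  refine (measureReal_mono fun Δ hΔ => ?_).trans (hb.trans_eq ?_)
  · rw [Set.mem_ofPred_eq, ← sub_nonpos, correlation_sub, ← hv] at hΔ
    rw [Set.mem_ofPred_eq]
    linarith
  · congr 1
    rcases Nat.eq_zero_or_pos n with h0 | h0
    · simp [h0]
    · have : (0 : ℝ) < n := by exact_mod_cast h0
      have : (0 : ℝ) < M * (2 / h) + 2 := by positivity
      field_simp
      norm_num

lemma delayLaw_repetitionCode_error_le {M : ℕ+} {T h N k : ℕ} (hh : 0 < h)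
    (hn : M * T = N * (2 * h)) (c : (Fin k → Bool) → (Fin N → Bool))
    (hc : ∀ m m', m ≠ m' → N ≤ 4 * hammingDist (c m) (c m')) (m : Fin k → Bool)
    (ξ : Fin (M * T) → Bool)
    (hξ : ((Finset.univ.filter fun j => ξ j = true).card : ℝ) ≤ (M * T : ℕ) / 32) :
    (delayLaw M (M * T)).real {Δ | (repetitionCode M T h c).dec
        (received ((repetitionCode M T h c).enc m) ξ Δ) ≠ m} ≤
      2 ^ k * Real.exp (-(M * T : ℕ) / (512 * (M * (2 / h) + 2) ^ 2)) := by
  set S : (Fin k → Bool) → Set (Fin (M * T) → ℕ) := fun m' => if m' = m then ∅ else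
    {Δ | correlation M h (c m) (received (repeatBits (2 * h) _ (c m)) ξ Δ) ≤
      correlation M h (c m') (received (repeatBits (2 * h) _ (c m)) ξ Δ)} with hS
  have hsub : {Δ | (repetitionCode M T h c).dec
      (received ((repetitionCode M T h c).enc m) ξ Δ) ≠ m} ⊆ ⋃ m', S m' := by
    intro Δ hΔ
    refine Set.mem_iUnion.mpr ⟨(repetitionCode M T h c).dec
      (received ((repetitionCode M T h c).enc m) ξ Δ), ?_⟩
    rw [hS]
    dsimp only
    rw [if_neg hΔ]
    exact repetitionCode_dec_spec M T h c _ m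
  refine (measureReal_mono hsub).trans ((measureReal_iUnion_fintype_le _).trans ?_)
  calc ∑ m', (delayLaw M (M * T)).real (S m')
      ≤ ∑ _m' : Fin k → Bool, Real.exp (-(M * T : ℕ) / (512 * (M * (2 / h) + 2) ^ 2)) := by
        refine Finset.sum_le_sum fun m' _ => ?_
        by_cases hm : m' = m
        · simp only [hS, if_pos hm, measureReal_empty]
          positivity
        · simp only [hS, if_neg hm]
          exact delayLaw_correlation_le hh hn _ _ (hc m m' (Ne.symm hm)) ξ hξ
    _ = _ := by simp

/-! ### From bounds for every noise pattern to the two channels -/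

lemma Code.decError_le {M : ℕ+} {T k : ℕ} (c : Code M T k) (ch : Channel) {δ : ℝ≥0∞}
    (h : ∀ m, ∀ P ∈ ch M T (c.enc m), P {Y | c.dec Y ≠ m} ≤ δ) : c.decError ch ≤ δ := by
  refine ENNReal.div_le_of_le_mul ?_
  calc _ ≤ ∑ _m : Fin k → Bool, δ := Finset.sum_le_sum fun m _ => iSup₂_le (h m)
    _ = _ := by simp [mul_comm]

lemma noiseLaw_card_ge_le {ε : unitInterval} (hε : (ε : ℝ) < 1 / 64) (n : ℕ) :
    (noiseLaw ε n).real
        {ξ | (n : ℝ) / 32 ≤ ((Finset.univ.filter fun j => ξ j = true).card : ℝ)} ≤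
      Real.exp (-n / 2048) := by
  have h := pi_real_add_le_sum_le (ι := Fin n) (bernoulliMeasure true false ε)
    (fun _ b => (if b = true then 1 else 0 : ℝ)) (a := 0) (b := 1) (t := n / 64)
    (fun _ b => by cases b <;> simp) (by positivity)
  refine (measureReal_mono fun ξ hξ => ?_).trans (h.trans_eq ?_)
  · rw [Set.mem_ofPred_eq, Finset.card_filter, Nat.cast_sum] at hξ
    simp only [Nat.cast_ite, Nat.cast_one, Nat.cast_zero] at hξ
    rw [Set.mem_ofPred_eq]
    refine le_trans ?_ hξ
    simp only [integral_bernoulliMeasure, Finset.sum_const, Finset.card_univ, Fintype.card_fin]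
    norm_num
    nlinarith [mul_le_mul_of_nonneg_left hε.le (Nat.cast_nonneg (α := ℝ) n)]
  · congr 1
    rw [Fintype.card_fin]
    rcases Nat.eq_zero_or_pos n with h0 | h0
    · simp [h0]
    · have : (0 : ℝ) < n := by exact_mod_cast h0
      field_simp
      norm_num

lemma Code.decError_advNoise_le {M : ℕ+} {T k : ℕ} (c : Code M T k) {ε : unitInterval}
    (hε : (ε : ℝ) < 1 / 64) {δ : ℝ≥0∞}
    (h : ∀ m (ξ : Fin (M * T) → Bool),
      ((Finset.univ.filter fun j => ξ j = true).card : ℝ) ≤ (M * T : ℕ) / 32 →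
      delayLaw M (M * T) {Δ | c.dec (received (c.enc m) ξ Δ) ≠ m} ≤ δ) :
    c.decError (advNoiseRandDelay ε) ≤ δ := by
  refine c.decError_le _ fun m P hP => ?_
  obtain ⟨ξ, hξ, rfl⟩ := hP
  rw [Measure.map_apply Measurable.of_discrete MeasurableSet.of_discrete]
  refine h m ξ (hξ.trans ?_)
  push_cast
  nlinarith [mul_le_mul_of_nonneg_right hε.le (show (0 : ℝ) ≤ (M : ℝ) * T by positivity),
    show (0 : ℝ) ≤ (M : ℝ) * T by positivity]

/-- Noise and delays are independent, so the noise can be fixed first; patterns of density at least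
1/32 are charged with error probability 1. -/
lemma Code.decError_randNoise_le {M : ℕ+} {T k : ℕ} (c : Code M T k) {ε : unitInterval}
    (hε : (ε : ℝ) < 1 / 64) {δ : ℝ≥0∞}
    (h : ∀ m (ξ : Fin (M * T) → Bool),
      ((Finset.univ.filter fun j => ξ j = true).card : ℝ) ≤ (M * T : ℕ) / 32 →
      delayLaw M (M * T) {Δ | c.dec (received (c.enc m) ξ Δ) ≠ m} ≤ δ) :
    c.decError (randDelayRandNoise ε) ≤
      δ + ENNReal.ofReal (Real.exp (-(M * T : ℕ) / 2048)) := by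
  refine c.decError_le _ fun m P hP => ?_
  rw [Set.mem_singleton_iff.mp hP,
    Measure.map_apply Measurable.of_discrete MeasurableSet.of_discrete,
    Measure.prod_apply_symm MeasurableSet.of_discrete]
  set A : Set (Fin (M * T) → Bool) :=
    {ξ | ((M * T : ℕ) : ℝ) / 32 ≤ ((Finset.univ.filter fun j => ξ j = true).card : ℝ)} with hA
  calc _ ≤ ∫⁻ ξ, (δ + A.indicator 1 ξ) ∂noiseLaw ε (M * T) := by
        refine lintegral_mono fun ξ => ?_
        by_cases hξ : ξ ∈ A
        · rw [Set.indicator_of_mem hξ, Pi.one_apply]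
          exact prob_le_one.trans le_add_self
        · rw [Set.indicator_of_notMem hξ, add_zero]
          exact h m ξ (not_le.mp hξ).le
    _ = δ + noiseLaw ε (M * T) A := by
        rw [lintegral_add_left measurable_const, lintegral_const, measure_univ, mul_one,
          lintegral_indicator_one MeasurableSet.of_discrete]
    _ ≤ _ := by
        gcongr
        rw [← ofReal_measureReal]
        exact ENNReal.ofReal_le_ofReal (noiseLaw_card_ge_le hε _)

/-! ### Codes of high rate -/

/-- The granularity used for the rate `r`. -/
def granularity (r : ℕ+) : ℕ+ := 2 ^ 22 * r ^ 3

/-- Uses `2 ≤ e` and `r * T + 1 + T ≤ 3 * r * T`. The factor 1/2 leaves room for the event of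
excessive random noise. -/
lemma two_pow_mul_exp_le {r T k : ℕ} (hr : 0 < r) (hT : 0 < T) (hk : k ≤ r * T) :
    2 ^ k * Real.exp (-(3 * r * T : ℝ)) ≤ Real.exp (-(T : ℝ)) / 2 := by
  have he : (2 : ℝ) ≤ Real.exp 1 := by linarith [Real.add_one_le_exp 1]
  have hr' : (1 : ℝ) ≤ r := by exact_mod_cast hr
  have hT' : (1 : ℝ) ≤ T := by exact_mod_cast hT
  have hk' : (k : ℝ) ≤ r * T := by exact_mod_cast hk
  have h2 : (2 : ℝ) ^ (k + 1) ≤ Real.exp (k + 1) := by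
    calc (2 : ℝ) ^ (k + 1) ≤ Real.exp 1 ^ (k + 1) := pow_le_pow_left₀ (by norm_num) he _
      _ = _ := by rw [← Real.exp_nat_mul]; push_cast; ring_nf
  have h3 : Real.exp (k + 1) * Real.exp (-(3 * r * T : ℝ)) ≤ Real.exp (-(T : ℝ)) := by
    rw [← Real.exp_add, Real.exp_le_exp]
    nlinarith [mul_le_mul_of_nonneg_right hr' (by linarith : (0 : ℝ) ≤ T)]
  have := (mul_le_mul_of_nonneg_right h2 (Real.exp_pos (-(3 * r * T : ℝ))).le).trans h3
  rw [pow_succ] at this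
  linarith

/-- At granularity `2 ^ 22 * r ^ 3`, the messages of at most `r * T` bits have a code that
withstands every noise pattern of density at most `1 / 32`. -/
lemma exists_code_delayLaw_error_le (r : ℕ+) {T k : ℕ} (hT : 0 < T) (hk : k ≤ r * T) :
    ∃ c : Code (granularity r) T k, ∀ m (ξ : Fin (granularity r * T) → Bool),
      ((Finset.univ.filter fun j => ξ j = true).card : ℝ) ≤ (granularity r * T : ℕ) / 32 →
      delayLaw (granularity r) (granularity r * T) {Δ | c.dec (received (c.enc m) ξ Δ) ≠ m} ≤
        ENNReal.ofReal (Real.exp (-(T : ℝ)) / 2) := by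
  obtain ⟨c, hc⟩ := exists_code_hammingDist_ge hk
  have hr : (1 : ℝ) ≤ (r : ℕ) := by exact_mod_cast r.pos
  have hg : ((granularity r : ℕ+) : ℕ) = 2 ^ 22 * (r : ℕ) ^ 3 := by simp [granularity]
  have hh : 0 < 2 ^ 18 * (r : ℕ) ^ 2 := by have := r.pos; positivity
  -- With this `h`, the `8 * r * T` blocks of length `2 * h` tile the `M * T` micro-intervals
  -- exactly, and `M / h = 16 * r`.
  refine ⟨repetitionCode _ T (2 ^ 18 * (r : ℕ) ^ 2) c, fun m ξ hξ => ?_⟩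
  rw [← ofReal_measureReal]
  refine ENNReal.ofReal_le_ofReal ?_
  refine (delayLaw_repetitionCode_error_le hh (by rw [hg]; ring) c
    (fun m m' h => by linarith [hc m m' h]) m ξ hξ).trans ?_
  refine le_trans ?_ (two_pow_mul_exp_le r.pos hT hk)
  refine mul_le_mul_of_nonneg_left (Real.exp_le_exp.mpr ?_) (by positivity)
  rw [neg_div, neg_le_neg_iff, le_div_iff₀ (by positivity)]
  push_cast [hg]
  have hK : (2 ^ 22 * (r : ℕ) ^ 3 * (2 / (2 ^ 18 * (r : ℕ) ^ 2)) + 2 : ℝ) ≤ 34 * (r : ℕ) := by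
    have : (2 ^ 22 * (r : ℕ) ^ 3 * (2 / (2 ^ 18 * (r : ℕ) ^ 2)) : ℝ) = 32 * (r : ℕ) := by
      field_simp; norm_num
    rw [this]; linarith
  calc _ ≤ 3 * ((r : ℕ) : ℝ) * T * (512 * (34 * (r : ℕ)) ^ 2) := by
        gcongr
        norm_num at hK ⊢
        exact hK
    _ = 1775616 * ((r : ℕ) ^ 3 * T : ℝ) := by ring
    _ ≤ 2 ^ 22 * ((r : ℕ) ^ 3 * T : ℝ) := by gcongr; norm_num
    _ = _ := by ring

lemma exists_code_decError_le {ε : unitInterval} (hε : (ε : ℝ) < 1 / 64) {ch : Channel}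
    (hch : ch = randDelayRandNoise ε ∨ ch = advNoiseRandDelay ε) (r : ℕ+) {T k : ℕ} (hT : 0 < T)
    (hk : k ≤ r * T) :
    ∃ c : Code (granularity r) T k, c.decError ch ≤ ENNReal.ofReal (Real.exp (-(T : ℝ))) := by
  obtain ⟨c, hc⟩ := exists_code_delayLaw_error_le r hT hk
  refine ⟨c, ?_⟩
  rcases hch with rfl | rfl
  · refine (c.decError_randNoise_le hε hc).trans ?_
    rw [← ENNReal.ofReal_add (by positivity) (by positivity)]
    refine ENNReal.ofReal_le_ofReal ?_
    have hr : (1 : ℝ) ≤ ((r : ℕ) : ℝ) ^ 3 := one_le_pow₀ (by exact_mod_cast r.pos)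
    have hT' : (1 : ℝ) ≤ T := by exact_mod_cast hT
    have hg : ((granularity r : ℕ+) : ℕ) = 2 ^ 22 * (r : ℕ) ^ 3 := by simp [granularity]
    have h1 : Real.exp (-(granularity r * T : ℕ) / 2048) ≤ Real.exp (-(3 * (1 : ℕ) * T : ℝ)) := by
      rw [Real.exp_le_exp, neg_div, neg_le_neg_iff]
      push_cast [hg]
      nlinarith [mul_le_mul_of_nonneg_right hr (by linarith : (0 : ℝ) ≤ T)]
    have h2 := two_pow_mul_exp_le one_pos hT (Nat.zero_le (1 * T))
    rw [pow_zero, one_mul] at h2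
    linarith
  · exact (c.decError_advNoise_le hε hc).trans
      (ENNReal.ofReal_le_ofReal (by linarith [Real.exp_pos (-(T : ℝ))]))

lemma capacity_eq_top {ε : unitInterval} (hε : (ε : ℝ) < 1 / 64) {ch : Channel}
    (hch : ch = randDelayRandNoise ε ∨ ch = advNoiseRandDelay ε) : capacity ch = ⊤ := by
  refine ENNReal.eq_top_of_forall_nnreal_le fun R => ?_
  obtain ⟨n, hn⟩ := exists_nat_gt R
  set r : ℕ+ := n.succPNat
  have hcode : ∀ T : ℕ, ∃ c : Code (granularity r) T (r * T),
      0 < T → c.decError ch ≤ ENNReal.ofReal (Real.exp (-(T : ℝ))) := by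
    intro T
    rcases Nat.eq_zero_or_pos T with hT | hT
    -- A system needs a code at `T = 0` too; any code will do.
    · exact ⟨⟨fun _ _ => false, fun _ _ => false⟩, fun h => absurd hT h.ne'⟩
    · obtain ⟨c, hc⟩ := exists_code_decError_le hε hch r hT le_rfl
      exact ⟨c, fun _ => hc⟩
  choose c hc using hcode
  let S : System (granularity r) := ⟨fun T => r * T, c⟩
  have hS : S.Reliable ch := by
    have hlim : Tendsto (fun T : ℕ => ENNReal.ofReal (Real.exp (-(T : ℝ)))) atTop (nhds 0) := by
      rw [← ENNReal.ofReal_zero]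
      exact ENNReal.tendsto_ofReal
        (Real.tendsto_exp_neg_atTop_nhds_zero.comp tendsto_natCast_atTop_atTop)
    exact tendsto_of_tendsto_of_tendsto_of_le_of_le' tendsto_const_nhds hlim
      (Eventually.of_forall fun _ => zero_le) ((eventually_gt_atTop 0).mono hc)
  have hrate : S.rate = (r : ℕ) := by
    have : (fun T : ℕ => (S.k T : ℝ≥0∞) / (T : ℝ≥0∞)) =ᶠ[atTop] fun _ => ((r : ℕ) : ℝ≥0∞) := by
      filter_upwards [eventually_gt_atTop 0] with T hT
      have h0 : (T : ℝ≥0∞) ≠ 0 := by exact_mod_cast hT.ne'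
      simp only [S, Nat.cast_mul]
      exact ENNReal.mul_div_cancel_right h0 (ENNReal.natCast_ne_top T)
    rw [System.rate, limsup_congr this, limsup_const]
  calc (R : ℝ≥0∞) ≤ (r : ℕ) := by
        have : (R : ℝ≥0∞) ≤ (n : ℕ) := by exact_mod_cast hn.le
        exact this.trans (by exact_mod_cast n.le_succ)
    _ = S.rate := hrate.symm
    _ ≤ capacity ch := le_iSup_of_le (granularity r) (le_iSup₂_of_le S hS le_rfl)

end DelayChannel

end

theorem theorem2 :
    (∀ ε : unitInterval, 0 < (ε : ℝ) → (ε : ℝ) < 1 / 64 →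
      DelayChannel.capacity (DelayChannel.randDelayRandNoise ε) = ⊤ ∧
      DelayChannel.capacity (DelayChannel.advNoiseRandDelay ε) = ⊤) ∧
    ∃ C : ℝ, ∀ ε : unitInterval, 0 < (ε : ℝ) → (ε : ℝ) < 1 / 64 →
      ∀ ch : DelayChannel.Channel,
        (ch = DelayChannel.randDelayRandNoise ε ∨ ch = DelayChannel.advNoiseRandDelay ε) →
        ∀ R : ℝ, 0 < R →
          ∃ M : ℕ+, (M : ℝ) ≤ C * max 1 R ^ 5 ∧
            ∃ T₀ : ℕ, ∀ T : ℕ, T₀ ≤ T →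
              ∃ c : DelayChannel.Code M T ⌈R * T⌉₊,
                c.decError ch ≤ ENNReal.ofReal (Real.exp (-(T : ℝ))) := by
  -- Rounding up gives `r ≤ 2 * max 1 R`, hence `2 ^ 22 * 2 ^ 3 = 2 ^ 25`. The construction needs
  -- only the cube of `max 1 R`.
  refine ⟨fun ε _ hε => ⟨DelayChannel.capacity_eq_top hε (Or.inl rfl),
    DelayChannel.capacity_eq_top hε (Or.inr rfl)⟩, 2 ^ 25, fun ε _ hε ch hch R _ => ?_⟩
  have h1 : 1 ≤ max 1 R := le_max_left _ _
  obtain ⟨r, hr⟩ : ∃ r : ℕ+, (r : ℕ) = ⌈max 1 R⌉₊ :=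
    ⟨⟨⌈max 1 R⌉₊, Nat.ceil_pos.mpr (by linarith)⟩, rfl⟩
  have hle : max 1 R ≤ (r : ℕ) := hr ▸ Nat.le_ceil _
  have hlt : ((r : ℕ) : ℝ) ≤ 2 * max 1 R := by
    have := Nat.ceil_lt_add_one (show 0 ≤ max 1 R by linarith)
    rw [hr]
    linarith
  refine ⟨DelayChannel.granularity r, ?_, 1, fun T hT =>
    DelayChannel.exists_code_decError_le hε hch r hT ?_⟩
  · calc ((DelayChannel.granularity r : ℕ) : ℝ) = 2 ^ 22 * ((r : ℕ) : ℝ) ^ 3 := by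
          norm_num [DelayChannel.granularity]
      _ ≤ 2 ^ 22 * (2 * max 1 R) ^ 3 := by gcongr
      _ = 2 ^ 25 * max 1 R ^ 3 := by ring
      _ ≤ 2 ^ 25 * max 1 R ^ 5 := by
          gcongr 2 ^ 25 * ?_
          exact pow_le_pow_right₀ h1 (by norm_num)
  · rw [Nat.ceil_le]
    push_cast
    exact mul_le_mul_of_nonneg_right ((le_max_right 1 R).trans hle) (Nat.cast_nonneg T)
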